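/- A lattice polytope $P\subset\mathbb{R}^d$ of dimension $d$ (a convex polytope of dimension $d$ all of whose vertices lie in $\mathbb{Z}^d$) having $b(P)$ lattice points on its boundary and $c(P)\ge 1$ lattice points in its interior is called Castelnuovo if its Lebesgue volume satisfies \[ \mathrm{vol}(P)=\frac{d\cdot c(P)+(d-1)\cdot b(P)-d^2+2}{d!}. \] Let $c\ge 1$, $d\ge 3$ and $0\le n<cd$ be integers, let $\mathbf e_1,\dots,\mathbf e_d$ be the canonical unit coordinate vectors of $\mathbb{R}^d$, and let $\mathcal P_{c,d}(n)\subset\mathbb{R}^d$ be the convex hull of the $d+2$ points \[ \mathbf 0,\ \mathbf e_1,\dots,\mathbf e_{d-1},\ \ \mathbf e_d+n\sum_{i=1}^d\mathbf e_i,\ \ \mathbf e_d+cd\sum_{i=1}^d\mathbf e_i . \] Then these points are precisely the vertices of $\mathcal P_{c,d}(n)$, and $\mathcal P_{c,d}(n)$ is a Castelnuovo lattice polytope of dimension $d$ with \[ b(\mathcal P_{c,d}(n))=cd-n+(d+1),\qquad c(\mathcal P_{c,d}(n))=c . \] -/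

import Mathlib

open MeasureTheory

/-- A lattice point of `ℝ^d`: a point all of whose coordinates are integers. -/
def IsLatticePoint {d : ℕ} (x : Fin d → ℝ) : Prop :=
  ∀ i, ∃ z : ℤ, x i = (z : ℝ)

/-- A lattice polytope of dimension `d` in `ℝ^d`: the convex hull of finitely many points, of
full dimension, each of whose vertices (extreme points) is a lattice point. -/
structure IsLatticePolytope {d : ℕ} (P : Set (Fin d → ℝ)) : Prop where
  polytope : ∃ S : Set (Fin d → ℝ), S.Finite ∧ P = convexHull ℝ S
  fullDim : affineSpan ℝ P = ⊤
  lattice_vertices : ∀ x ∈ P.extremePoints ℝ, IsLatticePoint x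

/-- The number of lattice points on the boundary of `P`. -/
noncomputable def boundaryLatticeCount {d : ℕ} (P : Set (Fin d → ℝ)) : ℕ :=
  {x | x ∈ frontier P ∧ IsLatticePoint x}.ncard

/-- The number of lattice points in the interior of `P`. -/
noncomputable def interiorLatticeCount {d : ℕ} (P : Set (Fin d → ℝ)) : ℕ :=
  {x | x ∈ interior P ∧ IsLatticePoint x}.ncard

/-- A lattice polytope of dimension `d` in `ℝ^d` with at least one interior lattice point is
Castelnuovo if its Lebesgue volume equals `(d * c + (d - 1) * b - d ^ 2 + 2) / d!`, where `b` and
`c` are the numbers of its boundary and interior lattice points. -/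
structure IsCastelnuovo {d : ℕ} (P : Set (Fin d → ℝ)) : Prop where
  latticePolytope : IsLatticePolytope P
  interior_pos : 0 < interiorLatticeCount P
  volume_eq : volume.real P =
    ((d : ℝ) * interiorLatticeCount P + ((d : ℝ) - 1) * boundaryLatticeCount P
      - (d : ℝ) ^ 2 + 2) / (d.factorial : ℝ)

/-- The point `e_d + m (e_1 + ⋯ + e_d)` of `ℝ^d`; the index of `e_d` is the `i : Fin d` with
`i + 1 = d`. -/
def bipyramidApex (d m : ℕ) : Fin d → ℝ :=
  (fun i : Fin d => if (i : ℕ) + 1 = d then (1 : ℝ) else 0) + (m : ℝ) • (1 : Fin d → ℝ)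

/-- The points `0`, `e_1, …, e_{d-1}`, `e_d + n (1, …, 1)` and `e_d + c d (1, …, 1)`. -/
def bipyramidVertices (c d n : ℕ) : Set (Fin d → ℝ) :=
  {0} ∪ {x | ∃ i : Fin d, (i : ℕ) + 1 < d ∧ x = Pi.single i 1} ∪
    {bipyramidApex d n, bipyramidApex d (c * d)}

/-- The polytope of bipyramid type. -/
def bipyramidPolytope (c d n : ℕ) : Set (Fin d → ℝ) :=
  convexHull ℝ (bipyramidVertices c d n)

/-!
Write `N = c * d`, let `a = e_d + n (1, …, 1)` and `b = e_d + N (1, …, 1)`, and let `l` be the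
index of `e_d`. The projection along `(1, …, 1)` sends both apices `a`, `b` to one point and the
origin to the barycentre of the simplex spanned by the images of `e_1, …, e_d`. The barycentric
coordinates of a point `x` in this shadow are
`shadowCoord x i = x i + (1 - ∑ j, x j) / d`, and two of them differ by the integer `x i - x j` when
`x` is a lattice point. As they are nonnegative with sum `1` on the polytope, its lattice points lie
above the barycentre or above a vertex of the shadow
(`IsLatticePoint.eq_of_shadowCoord_nonneg`). Above the barycentre these are the `t (1, …, 1)` with
`0 ≤ t ≤ c`, all of them interior except the origin, above the image of `e_l` the points of the edge
from `a` to `b`, and above every other vertex only the vertex `e_i` itself.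

The facet inequalities used for this (`facetRegion`) are obtained from a triangulation of the
polytope into two simplices, `0, e_1, …, e_{d-1}, a` and `e_1, …, e_{d-1}, a, b`
(`convexHull_apexVertices_eq_union`): the vertices satisfy the inequalities, and a point
satisfying them lies in one of the two simplices. The first simplex is the image of the corner
simplex, of volume `1 / d!`, under a linear map differing from the identity by rank at most one,
and the second is the image of the first under an affine map, again with linear part of this kind,
which fixes the common facet and sends `0` to `b`. Thus `volume_setOf_add_smul_mem` gives the
volumes `(n + 1) / d!` and `d (N - n) / d!`, and their sum is the required one. Each of the `d +
2` points is a vertex because some linear functional attains its maximum over these points only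
there.
-/

/-! ### Volumes of the corner simplex and of affine preimages -/

/-- The corner simplex of size `s` has volume `s ^ d / d!`, by slicing along the first
coordinate. -/
lemma volume_corner_simplex (d : ℕ) : ∀ s : ℝ, 0 ≤ s →
    volume {x : Fin d → ℝ | (∀ i, 0 ≤ x i) ∧ ∑ i, x i ≤ s} =
      ENNReal.ofReal (s ^ d / d.factorial) := by
  induction d with
  | zero =>
    intro s hs
    have : {x : Fin 0 → ℝ | (∀ i, 0 ≤ x i) ∧ ∑ i, x i ≤ s} = Set.univ := by
      ext x; simp [hs]
    rw [this]
    simp [volume_pi]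
  | succ d ih =>
    intro s hs
    set A : Set (ℝ × (Fin d → ℝ)) :=
      {p | 0 ≤ p.1 ∧ (∀ i, 0 ≤ p.2 i) ∧ p.1 + ∑ i, p.2 i ≤ s} with hA
    have hAm : MeasurableSet A := by
      refine IsClosed.measurableSet ?_
      refine (isClosed_le continuous_const continuous_fst).inter (IsClosed.inter ?_ ?_)
      · have : {p : ℝ × (Fin d → ℝ) | ∀ i, 0 ≤ p.2 i} = ⋂ i, {p | 0 ≤ p.2 i} := by
          ext; simp
        change IsClosed {p : ℝ × (Fin d → ℝ) | ∀ i, 0 ≤ p.2 i}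
        rw [this]
        exact isClosed_iInter fun i => isClosed_le continuous_const (by fun_prop)
      · exact isClosed_le (f := fun p : ℝ × (Fin d → ℝ) => p.1 + ∑ i, p.2 i) (by fun_prop)
          continuous_const
    have hpre : {x : Fin (d + 1) → ℝ | (∀ i, 0 ≤ x i) ∧ ∑ i, x i ≤ s} =
        MeasurableEquiv.piFinSuccAbove (fun _ => ℝ) 0 ⁻¹' A := by
      ext x
      simp [hA, Fin.forall_fin_succ, Fin.sum_univ_succ, MeasurableEquiv.piFinSuccAbove,
        Fin.insertNthEquiv, Fin.tail, and_assoc]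
    rw [hpre, (volume_preserving_piFinSuccAbove (fun _ : Fin (d + 1) => ℝ) 0).measure_preimage
      hAm.nullMeasurableSet, Measure.volume_eq_prod, Measure.prod_apply hAm]
    have hslice : ∀ t : ℝ, volume (Prod.mk t ⁻¹' A) =
        (Set.Icc 0 s).indicator
          (fun t => ENNReal.ofReal ((s - t) ^ d / d.factorial)) t := by
      intro t
      by_cases ht : t ∈ Set.Icc 0 s
      · rw [Set.indicator_of_mem ht, ← ih (s - t) (by linarith [ht.2])]
        congr 1
        ext x
        simp [hA, ht.1, le_sub_iff_add_le']
      · rw [Set.indicator_of_notMem ht]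
        convert measure_empty (μ := (volume : Measure (Fin d → ℝ)))
        ext x
        simp only [hA, Set.mem_preimage, Set.mem_ofPred_eq, Set.mem_empty_iff_false, iff_false]
        rintro ⟨h0, hx, h⟩
        exact ht ⟨h0, by linarith [Finset.sum_nonneg fun i (_ : i ∈ Finset.univ) => hx i]⟩
    simp_rw [hslice]
    rw [lintegral_indicator measurableSet_Icc, ← ofReal_integral_eq_lintegral_ofReal]
    · congr 1
      rw [integral_Icc_eq_integral_Ioc, ← intervalIntegral.integral_of_le hs,
        intervalIntegral.integral_comp_sub_left (fun u => u ^ d / (d.factorial : ℝ)),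
        intervalIntegral.integral_div, integral_pow]
      push_cast [Nat.factorial_succ]
      simp
      field_simp
    · exact (Continuous.continuousOn (by fun_prop)).integrableOn_Icc
    · refine (ae_restrict_iff' measurableSet_Icc).2 (.of_forall fun t ht => ?_)
      have : 0 ≤ s - t := by linarith [ht.2]
      positivity

/-- Preimages under an affine map whose linear part `x ↦ x + f x • v` differs from the identity by
an operator of rank one, whence its determinant is `1 + f v`. -/
lemma volume_setOf_add_smul_mem {d : ℕ} (f : (Fin d → ℝ) →ₗ[ℝ] ℝ) (v : Fin d → ℝ) (r : ℝ)
    (h : 1 + f v ≠ 0) (T : Set (Fin d → ℝ)) :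
    volume {x | x + (f x + r) • v ∈ T} = ENNReal.ofReal |(1 + f v)⁻¹| * volume T := by
  have hdet := LinearMap.transvection.det f v
  have : {x | x + (f x + r) • v ∈ T} =
      LinearMap.transvection f v ⁻¹' ((fun y => y + r • v) ⁻¹' T) := by
    ext x
    simp [LinearMap.transvection.apply, add_smul, add_assoc]
  rw [this, Measure.addHaar_preimage_linearMap _ (by rwa [hdet]), hdet,
    measure_preimage_add_right]

lemma volume_setOf_eq_const {d : ℕ} (f : (Fin d → ℝ) →ₗ[ℝ] ℝ) (hf : f ≠ 0) (r : ℝ) :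
    volume {x | f x = r} = 0 := by
  obtain ⟨p, hp⟩ := LinearMap.surjective hf r
  have : {x | f x = r} = (AffineSubspace.mk' p (LinearMap.ker f) : Set (Fin d → ℝ)) := by
    ext x
    simp [AffineSubspace.mem_mk', sub_eq_zero, hp]
  rw [this]
  refine Measure.addHaar_affineSubspace _ _ fun h => hf ?_
  have := congrArg AffineSubspace.direction h
  rw [AffineSubspace.direction_mk', AffineSubspace.direction_top] at this
  exact LinearMap.ker_eq_top.1 this

/-! ### Convex combinations and extreme points -/

/-- A point of a generating set at which some linear functional attains its maximum over that
set, and attains it nowhere else on it, is an extreme point of the convex hull. -/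
lemma mem_extremePoints_convexHull_of_forall_lt {E : Type*} [AddCommGroup E] [Module ℝ E]
    {S : Set E} {v : E} (hv : v ∈ S) (f : E →ₗ[ℝ] ℝ) (h : ∀ w ∈ S, w ≠ v → f w < f v) :
    v ∈ (convexHull ℝ S).extremePoints ℝ := by
  have hS : ∀ x ∈ convexHull ℝ S, f x < f v ∨ x = v := by
    have hconv : Convex ℝ {x | f x < f v ∨ x = v} := by
      refine convex_iff_forall_pos.2 fun x hx y hy a b ha hb hab => ?_
      simp only [Set.mem_ofPred_eq] at hx hy ⊢
      have hv' : f v = a * f v + b * f v := by rw [← add_mul, hab, one_mul]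
      simp only [map_add, map_smul, smul_eq_mul]
      rcases hx with hx | rfl <;> rcases hy with hy | rfl
      · left; nlinarith [mul_lt_mul_of_pos_left hx ha, mul_lt_mul_of_pos_left hy hb]
      · left; nlinarith [mul_lt_mul_of_pos_left hx ha]
      · left; nlinarith [mul_lt_mul_of_pos_left hy hb]
      · right; rw [← add_smul, hab, one_smul]
    refine fun x hx => convexHull_min (fun w hw => ?_) hconv hx
    by_cases hwv : w = v
    · exact Or.inr hwv
    · exact Or.inl (h w hw hwv)
  refine ⟨subset_convexHull ℝ S hv, fun x hx y hy hxy => ?_⟩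
  obtain ⟨a, b, ha, hb, hab, rfl⟩ := hxy
  set v := a • x + b • y with hvdef
  have e : f v = a * f x + b * f y := by simp [hvdef]
  have e' : f v = a * f v + b * f v := by rw [← add_mul, hab, one_mul]
  rcases hS x hx with hx' | hx'
  · have h1 := mul_lt_mul_of_pos_left hx' ha
    have h2 : b * f y ≤ b * f v := by
      rcases hS y hy with hy' | hy'
      · exact (mul_lt_mul_of_pos_left hy' hb).le
      · rw [hy']
    linarith
  · exact hx'

lemma Convex.smul_add_sum_smul_mem {E ι : Type*} [AddCommGroup E] [Module ℝ E] [Fintype ι]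
    {s : Set E} (hs : Convex ℝ s) {p : E} (hp : p ∈ s) {z : ι → E} (hz : ∀ i, z i ∈ s)
    {a : ℝ} (ha : 0 ≤ a) {w : ι → ℝ} (hw : ∀ i, 0 ≤ w i) (h1 : a + ∑ i, w i = 1) :
    a • p + ∑ i, w i • z i ∈ s := by
  have := hs.sum_mem (t := Finset.univ) (w := fun o : Option ι => o.elim a w)
    (z := fun o => o.elim p z) (by rintro (_ | i) _ <;> simp [ha, hw])
    (by simpa [Fintype.sum_option] using h1) (by rintro (_ | i) _ <;> simp [hp, hz])
  simpa [Fintype.sum_option] using this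

/-! ### Coordinates in the shadow -/

/-- The point `e_l + m (1, …, 1)`, for a real height `m`. -/
noncomputable def apexPoint {d : ℕ} (l : Fin d) (m : ℝ) : Fin d → ℝ :=
  Pi.single l 1 + m • (1 : Fin d → ℝ)

lemma apexPoint_apply {d : ℕ} (l : Fin d) (m : ℝ) (i : Fin d) :
    apexPoint l m i = (if i = l then 1 else 0) + m := by
  simp [apexPoint, Pi.single_apply]

/-- The points `0`, `e_i` for `i ≠ l`, `e_l + n (1, …, 1)` and `e_l + N (1, …, 1)`. -/
def apexVertices {d : ℕ} (l : Fin d) (n N : ℝ) : Set (Fin d → ℝ) :=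
  {0} ∪ {x | ∃ i : Fin d, i ≠ l ∧ x = Pi.single i 1} ∪ {apexPoint l n, apexPoint l N}

/-- The barycentric coordinates of the image of `x` under the projection along `(1, …, 1)`, with
respect to the simplex spanned by the images of `e_1, …, e_d`. -/
noncomputable def shadowCoord {d : ℕ} (x : Fin d → ℝ) (i : Fin d) : ℝ :=
  x i + (1 - ∑ j, x j) / d

lemma continuous_shadowCoord {d : ℕ} (i : Fin d) :
    Continuous fun x : Fin d → ℝ => shadowCoord x i := by
  unfold shadowCoord
  fun_prop

lemma sum_shadowCoord {d : ℕ} (hd : d ≠ 0) (x : Fin d → ℝ) : ∑ i, shadowCoord x i = 1 := by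
  simp only [shadowCoord, Finset.sum_add_distrib, Finset.sum_const, Finset.card_univ,
    Fintype.card_fin, nsmul_eq_mul]
  field_simp
  ring

lemma shadowCoord_smul_add_smul {d : ℕ} (x y : Fin d → ℝ) (i : Fin d) {a b : ℝ}
    (hab : a + b = 1) :
    shadowCoord (a • x + b • y) i = a * shadowCoord x i + b * shadowCoord y i := by
  obtain rfl : b = 1 - a := by linarith
  simp only [shadowCoord, Pi.add_apply, Pi.smul_apply, smul_eq_mul, Finset.sum_add_distrib,
    ← Finset.mul_sum]
  ring

lemma sum_apexPoint {d : ℕ} (l : Fin d) (m : ℝ) : ∑ i, apexPoint l m i = 1 + d * m := by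
  simp [apexPoint_apply, Finset.sum_add_distrib]

lemma shadowCoord_apexPoint {d : ℕ} (hd : d ≠ 0) (l : Fin d) (m : ℝ) (i : Fin d) :
    shadowCoord (apexPoint l m) i = if i = l then 1 else 0 := by
  rw [shadowCoord, sum_apexPoint, apexPoint_apply]
  field_simp
  ring

lemma apexPoint_zero {d : ℕ} (l : Fin d) : apexPoint l 0 = Pi.single l 1 := by
  simp [apexPoint]

lemma shadowCoord_single {d : ℕ} (hd : d ≠ 0) (j : Fin d) (i : Fin d) :
    shadowCoord (Pi.single j 1) i = if i = j then 1 else 0 := by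
  rw [← apexPoint_zero, shadowCoord_apexPoint hd]

lemma shadowCoord_smul_one {d : ℕ} (t : ℝ) (i : Fin d) :
    shadowCoord (t • (1 : Fin d → ℝ)) i = 1 / d := by
  have hd : (0 : ℝ) < d := by exact_mod_cast i.pos
  simp [shadowCoord]
  field_simp
  ring

lemma shadowCoord_zero {d : ℕ} (i : Fin d) : shadowCoord (0 : Fin d → ℝ) i = 1 / d := by
  simpa using shadowCoord_smul_one 0 i

/-! ### Facet inequalities and the triangulation into two simplices -/

/-- The simplex spanned by `0`, the `e_i` with `i ≠ l`, and `apexPoint l n`, by inequalities. -/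
def lowerSimplex {d : ℕ} (l : Fin d) (n : ℝ) : Set (Fin d → ℝ) :=
  {x | (∀ i, n * x l ≤ (n + 1) * x i) ∧ x l ≤ (n + 1) * shadowCoord x l}

/-- The simplex spanned by the `e_i` with `i ≠ l`, `apexPoint l n` and `apexPoint l N`, by
inequalities. -/
def upperSimplex {d : ℕ} (l : Fin d) (n N : ℝ) : Set (Fin d → ℝ) :=
  {x | (∀ i ≠ l, 0 ≤ shadowCoord x i) ∧ (n + 1) * shadowCoord x l ≤ x l ∧
    x l ≤ (N + 1) * shadowCoord x l}

/-- The region cut out by the facet inequalities of the convex hull of `apexVertices l n N`. For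
`i = l` the first family reads `0 ≤ x l`; the case `i = l` of the second one follows from the rest
but is convenient to have. -/
def facetRegion {d : ℕ} (l : Fin d) (n N : ℝ) : Set (Fin d → ℝ) :=
  {x | (∀ i, n * x l ≤ (n + 1) * x i) ∧ (∀ i, 0 ≤ shadowCoord x i) ∧
    x l ≤ (N + 1) * shadowCoord x l}

lemma convex_facetRegion {d : ℕ} (l : Fin d) (n N : ℝ) : Convex ℝ (facetRegion l n N) := by
  rintro x ⟨hx1, hx2, hx3⟩ y ⟨hy1, hy2, hy3⟩ a b ha hb hab
  refine ⟨fun i => ?_, fun i => ?_, ?_⟩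
  · have h1 := mul_le_mul_of_nonneg_left (hx1 i) ha
    have h2 := mul_le_mul_of_nonneg_left (hy1 i) hb
    simp only [Pi.add_apply, Pi.smul_apply, smul_eq_mul]
    linarith
  · rw [shadowCoord_smul_add_smul x y i hab]
    have := hx2 i
    have := hy2 i
    positivity
  · rw [shadowCoord_smul_add_smul x y l hab]
    have h1 := mul_le_mul_of_nonneg_left hx3 ha
    have h2 := mul_le_mul_of_nonneg_left hy3 hb
    simp only [Pi.add_apply, Pi.smul_apply, smul_eq_mul]
    linarith

lemma apexVertices_subset_facetRegion {d : ℕ} (l : Fin d) {n N : ℝ} (hn : 0 ≤ n) (hN : n < N) :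
    apexVertices l n N ⊆ facetRegion l n N := by
  have hd : d ≠ 0 := by rintro rfl; exact l.elim0
  have hapex : ∀ m, n ≤ m → m ≤ N → apexPoint l m ∈ facetRegion l n N := by
    intro m h1 h2
    refine ⟨fun i => ?_, fun i => ?_, ?_⟩
    · simp only [apexPoint_apply, if_true]
      split_ifs <;> linarith
    · rw [shadowCoord_apexPoint hd]
      split_ifs <;> norm_num
    · rw [shadowCoord_apexPoint hd, apexPoint_apply]
      simp only [if_true]
      linarith
  rintro x ((rfl | ⟨j, hj, rfl⟩) | rfl | rfl)
  · refine ⟨fun i => by simp, fun i => ?_, ?_⟩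
    · rw [shadowCoord_zero]; positivity
    · rw [shadowCoord_zero]
      have : 0 ≤ N + 1 := by linarith
      simp only [Pi.zero_apply]
      positivity
  · refine ⟨fun i => ?_, fun i => ?_, ?_⟩
    · simp only [Pi.single_apply, if_neg hj.symm, mul_zero]
      split_ifs <;> linarith
    · rw [shadowCoord_single hd]
      split_ifs <;> norm_num
    · rw [shadowCoord_single hd]
      simp [hj.symm]
  · exact hapex n le_rfl hN.le
  · exact hapex N hN.le le_rfl

lemma facetRegion_subset_union {d : ℕ} (l : Fin d) (n N : ℝ) :
    facetRegion l n N ⊆ lowerSimplex l n ∪ upperSimplex l n N := by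
  rintro x ⟨h1, h2, h3⟩
  rcases le_total (x l) ((n + 1) * shadowCoord x l) with h | h
  · exact Or.inl ⟨h1, h⟩
  · exact Or.inr ⟨fun i _ => h2 i, h, h3⟩

/-- The vertices of the common facet of the two simplices, indexed by `Fin d`. -/
lemma ite_apexPoint_mem_apexVertices {d : ℕ} (l : Fin d) (n N : ℝ) (i : Fin d) :
    (if i = l then apexPoint l n else Pi.single i 1) ∈ apexVertices l n N := by
  split_ifs with h
  · simp [apexVertices]
  · exact Or.inl (Or.inr ⟨i, h, rfl⟩)

lemma sum_smul_ite_apexPoint {d : ℕ} (l : Fin d) (n : ℝ) (w : Fin d → ℝ) :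
    ∑ i, w i • (if i = l then apexPoint l n else Pi.single i 1) = w + (n * w l) • 1 := by
  have : ∀ i, w i • (if i = l then apexPoint l n else Pi.single i 1) =
      Pi.single i (w i) + if i = l then (n * w l) • (1 : Fin d → ℝ) else 0 := by
    intro i
    split_ifs with h
    · subst h
      ext j
      simp [apexPoint_apply, Pi.single_apply, mul_add, mul_comm]
    · ext j
      simp [Pi.single_apply]
  simp only [this, Finset.sum_add_distrib, Finset.univ_sum_single, Finset.sum_ite_eq',
    Finset.mem_univ, if_true]

/-- The weights of `apexPoint l n` and the `e_i` are `x i - n / (n + 1) * x l`, that of the origin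
is the remainder. -/
lemma lowerSimplex_subset_convexHull {d : ℕ} (l : Fin d) {n : ℝ} (N : ℝ) (hn : 0 ≤ n) :
    lowerSimplex l n ⊆ convexHull ℝ (apexVertices l n N) := by
  rintro x ⟨h1, h2⟩
  have hd : (0 : ℝ) < d := by exact_mod_cast l.pos
  set w : Fin d → ℝ := fun i => x i - n / (n + 1) * x l with hw
  have hw0 : ∀ i, 0 ≤ w i := by
    intro i
    have := h1 i
    rw [hw]
    dsimp only
    rw [sub_nonneg, div_mul_eq_mul_div, div_le_iff₀ (by linarith)]
    linarith
  have hsum : ∑ i, w i = ∑ i, x i - d * (n / (n + 1) * x l) := by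
    simp [hw, Finset.sum_sub_distrib]
  have hle : ∑ i, w i ≤ 1 := by
    rw [hsum]
    rw [shadowCoord] at h2
    have hn1 : 0 < n + 1 := by linarith
    field_simp at h2 ⊢
    linarith
  have hx : x = (1 - ∑ i, w i) • (0 : Fin d → ℝ) +
      ∑ i, w i • (if i = l then apexPoint l n else Pi.single i 1) := by
    rw [sum_smul_ite_apexPoint]
    ext i
    have hn1 : 0 < n + 1 := by linarith
    simp [hw]
    field_simp
    ring
  rw [hx]
  refine (convex_convexHull ℝ _).smul_add_sum_smul_mem ?_ ?_ (by linarith) hw0 (by ring)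
  · exact subset_convexHull ℝ _ (by simp [apexVertices])
  · exact fun i => subset_convexHull ℝ _ (ite_apexPoint_mem_apexVertices l n N i)

/-- The weight of `e_i` is `shadowCoord x i`; the weight `shadowCoord x l` of the vertex of the
shadow under both apices is shared between them so that the `l`-th coordinate is right. -/
lemma upperSimplex_subset_convexHull {d : ℕ} (l : Fin d) {n N : ℝ} (hN : n < N) :
    upperSimplex l n N ⊆ convexHull ℝ (apexVertices l n N) := by
  rintro x ⟨h1, h2, h3⟩
  have hd : d ≠ 0 := by rintro rfl; exact l.elim0
  have hNn : 0 < N - n := by linarith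
  set β : ℝ := (x l - (n + 1) * shadowCoord x l) / (N - n) with hβ
  have hβ0 : 0 ≤ β := div_nonneg (by linarith) hNn.le
  set w : Fin d → ℝ := fun i => shadowCoord x i - if i = l then β else 0 with hw
  have hw0 : ∀ i, 0 ≤ w i := by
    intro i
    rw [hw]
    dsimp only
    split_ifs with h
    · rw [h, sub_nonneg, hβ, div_le_iff₀ hNn]
      linarith
    · simpa using h1 i h
  have hsum : β + ∑ i, w i = 1 := by
    simp [hw, Finset.sum_sub_distrib, sum_shadowCoord hd]
  have hx : x = β • apexPoint l N +
      ∑ i, w i • (if i = l then apexPoint l n else Pi.single i 1) := by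
    rw [sum_smul_ite_apexPoint]
    have key : β * (N - n) = x l - (n + 1) * shadowCoord x l := by
      rw [hβ]; field_simp
    ext i
    have hi : shadowCoord x i - x i = shadowCoord x l - x l := by simp [shadowCoord]
    simp only [hw, Pi.add_apply, Pi.smul_apply, smul_eq_mul, Pi.one_apply, apexPoint_apply,
      if_true]
    split_ifs <;> linarith
  rw [hx]
  refine (convex_convexHull ℝ _).smul_add_sum_smul_mem ?_ ?_ hβ0 hw0 hsum
  · exact subset_convexHull ℝ _ (by simp [apexVertices])
  · exact fun i => subset_convexHull ℝ _ (ite_apexPoint_mem_apexVertices l n N i)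

lemma convexHull_apexVertices_subset {d : ℕ} (l : Fin d) {n N : ℝ} (hn : 0 ≤ n) (hN : n < N) :
    convexHull ℝ (apexVertices l n N) ⊆ facetRegion l n N :=
  convexHull_min (apexVertices_subset_facetRegion l hn hN) (convex_facetRegion l n N)

lemma convexHull_apexVertices_eq_union {d : ℕ} (l : Fin d) {n N : ℝ} (hn : 0 ≤ n)
    (hN : n < N) :
    convexHull ℝ (apexVertices l n N) = lowerSimplex l n ∪ upperSimplex l n N :=
  ((convexHull_apexVertices_subset l hn hN).trans (facetRegion_subset_union l n N)).antisymm
    (Set.union_subset (lowerSimplex_subset_convexHull l N hn) (upperSimplex_subset_convexHull l hN))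

lemma convexHull_apexVertices_eq_facetRegion {d : ℕ} (l : Fin d) {n N : ℝ} (hn : 0 ≤ n)
    (hN : n < N) : convexHull ℝ (apexVertices l n N) = facetRegion l n N :=
  (convexHull_apexVertices_subset l hn hN).antisymm
    ((facetRegion_subset_union l n N).trans (convexHull_apexVertices_eq_union l hn hN).ge)

/-! ### Volume of the polytope -/

lemma volume_lowerSimplex {d : ℕ} (l : Fin d) {n : ℝ} (hn : 0 ≤ n) :
    volume (lowerSimplex l n) = ENNReal.ofReal ((n + 1) / d.factorial) := by
  have hd : (0 : ℝ) < d := by exact_mod_cast l.pos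
  have hn1 : 0 < n + 1 := by linarith
  have h1 : 1 + ((-(n / (n + 1))) • LinearMap.proj l : (Fin d → ℝ) →ₗ[ℝ] ℝ) 1 = 1 / (n + 1) := by
    simp
    field_simp
    ring
  have hset : lowerSimplex l n = {x | x + (((-(n / (n + 1))) • LinearMap.proj l :
      (Fin d → ℝ) →ₗ[ℝ] ℝ) x + 0) • (1 : Fin d → ℝ) ∈
        {x : Fin d → ℝ | (∀ i, 0 ≤ x i) ∧ ∑ i, x i ≤ 1}} := by
    ext x
    simp only [lowerSimplex, shadowCoord, Set.mem_ofPred_eq, Pi.add_apply, Pi.smul_apply,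
      LinearMap.smul_apply, LinearMap.proj_apply, smul_eq_mul, Pi.one_apply, add_zero, mul_one,
      Finset.sum_add_distrib, Finset.sum_const, Finset.card_univ, Fintype.card_fin, nsmul_eq_mul]
    refine and_congr (forall_congr' fun i => ?_) ?_
    · rw [show x i + -(n / (n + 1)) * x l = ((n + 1) * x i - n * x l) / (n + 1) by
        field_simp; ring, le_div_iff₀ hn1, zero_mul, sub_nonneg]
    · rw [show ∑ i, x i + d * (-(n / (n + 1)) * x l) =
        1 + d / (n + 1) * (x l - (n + 1) * (x l + (1 - ∑ i, x i) / d)) by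
          field_simp; ring, add_le_iff_nonpos_right, ← not_lt (a := 0),
          mul_pos_iff_of_pos_left (by positivity), not_lt,
          sub_nonpos]
  rw [hset, volume_setOf_add_smul_mem _ _ _ (by rw [h1]; positivity),
    volume_corner_simplex d 1 zero_le_one, h1, ← ENNReal.ofReal_mul (abs_nonneg _)]
  simp [abs_of_pos hn1, div_eq_mul_inv]

/-- The linear part of `(n + 1) * shadowCoord x l - x l`, which vanishes on the common facet of
`lowerSimplex` and `upperSimplex`. -/
noncomputable def hinge {d : ℕ} (l : Fin d) (n : ℝ) : (Fin d → ℝ) →ₗ[ℝ] ℝ :=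
  n • LinearMap.proj l - ((n + 1) / d) • ∑ i, LinearMap.proj i

lemma hinge_apply {d : ℕ} (l : Fin d) (n : ℝ) (x : Fin d → ℝ) :
    hinge l n x = n * x l - (n + 1) / d * ∑ i, x i := by
  simp [hinge, LinearMap.sum_apply]

lemma hinge_add {d : ℕ} (l : Fin d) (n : ℝ) (x : Fin d → ℝ) :
    hinge l n x + (n + 1) / d = (n + 1) * shadowCoord x l - x l := by
  rw [hinge_apply, shadowCoord]
  ring

lemma hinge_apexPoint {d : ℕ} (l : Fin d) (n N : ℝ) :
    hinge l n (apexPoint l N) = n - N - (n + 1) / d := by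
  have hd : (0 : ℝ) < d := by exact_mod_cast l.pos
  rw [hinge_apply, sum_apexPoint, apexPoint_apply, if_pos rfl]
  field_simp
  ring

lemma volume_lowerSimplex_inter_upperSimplex {d : ℕ} (l : Fin d) {n N : ℝ} (hn : 0 ≤ n)
    (hN : n < N) : volume (lowerSimplex l n ∩ upperSimplex l n N) = 0 := by
  have hf : hinge l n ≠ 0 := by
    intro h
    have h1 := hinge_apexPoint l n N
    rw [h, LinearMap.zero_apply] at h1
    have : 0 ≤ (n + 1) / d := by positivity
    linarith
  refine measure_mono_null ?_ (volume_setOf_eq_const (hinge l n) hf (-((n + 1) / d)))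
  rintro x ⟨⟨-, h1⟩, -, h2, -⟩
  have := hinge_add l n x
  change hinge l n x = _
  linarith

/-- The affine map fixing the common facet and exchanging `apexPoint l N` for the origin carries
`upperSimplex` to `lowerSimplex`. -/
lemma upperSimplex_eq_preimage {d : ℕ} (l : Fin d) {n N : ℝ} (hn : 0 ≤ n) (hN : n < N) :
    upperSimplex l n N = {x | x + (((N - n)⁻¹ • hinge l n) x + (N - n)⁻¹ * ((n + 1) / d)) •
      apexPoint l N ∈ lowerSimplex l n} := by
  have hd : (0 : ℝ) < d := by exact_mod_cast l.pos
  have hNn : 0 < N - n := by linarith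
  have hn1 : 0 < n + 1 := by linarith
  ext x
  set t : ℝ := ((N - n)⁻¹ • hinge l n) x + (N - n)⁻¹ * ((n + 1) / d) with ht
  have key : t * (N - n) = (n + 1) * shadowCoord x l - x l := by
    rw [← hinge_add, ht, LinearMap.smul_apply, smul_eq_mul]
    field_simp
  have hcoord : ∀ i, (x + t • apexPoint l N) i = x i + t * ((if i = l then 1 else 0) + N) := by
    simp [apexPoint_apply]
  have hshadow : shadowCoord (x + t • apexPoint l N) l = shadowCoord x l + t - t / d := by
    rw [shadowCoord, hcoord]
    simp only [Pi.add_apply, Pi.smul_apply, smul_eq_mul, Finset.sum_add_distrib, ← Finset.mul_sum,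
      sum_apexPoint, shadowCoord, if_true]
    field_simp
    ring
  have hne : ∀ i ≠ l, (n + 1) * (x + t • apexPoint l N) i - n * (x + t • apexPoint l N) l =
      (n + 1) * shadowCoord x i := by
    intro i hi
    have : shadowCoord x i - x i = shadowCoord x l - x l := by simp [shadowCoord]
    rw [hcoord, hcoord, if_neg hi, if_pos rfl]
    linear_combination key - (n + 1) * this
  have heq : (N - n) * (x + t • apexPoint l N) l =
      (n + 1) * ((N + 1) * shadowCoord x l - x l) := by
    rw [hcoord, if_pos rfl]
    linear_combination (N + 1) * key
  have htop : (n + 1) * shadowCoord (x + t • apexPoint l N) l - (x + t • apexPoint l N) l =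
      -((n + 1) / d * t) := by
    rw [hshadow, hcoord, if_pos rfl]
    linear_combination -key
  change _ ↔ (∀ i, _) ∧ _
  constructor
  · rintro ⟨h1, h2, h3⟩
    refine ⟨fun i => ?_, ?_⟩
    · by_cases hi : i = l
      · subst hi
        have : 0 ≤ (N - n) * (x + t • apexPoint i N) i := by
          rw [heq]
          exact mul_nonneg hn1.le (by linarith)
        have := nonneg_of_mul_nonneg_right this hNn
        linarith
      · have := mul_nonneg hn1.le (h1 i hi)
        rw [← hne i hi] at this
        linarith
    · have ht0 : t ≤ 0 := by
        by_contra! h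
        have := mul_pos h hNn
        linarith
      have : 0 ≤ (n + 1) / d * (-t) := mul_nonneg (by positivity) (by linarith)
      linarith
  · rintro ⟨h1, h2⟩
    have ht0 : t ≤ 0 := by
      by_contra! h
      have : 0 < (n + 1) / d * t := by positivity
      linarith
    refine ⟨fun i hi => ?_, ?_, ?_⟩
    · refine nonneg_of_mul_nonneg_right (a := n + 1) ?_ hn1
      rw [← hne i hi]
      linarith [h1 i]
    · have := mul_nonpos_of_nonpos_of_nonneg ht0 hNn.le
      linarith
    · have h3 : 0 ≤ (n + 1) * ((N + 1) * shadowCoord x l - x l) := by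
        rw [← heq]
        exact mul_nonneg hNn.le (by linarith [h1 l])
      linarith [nonneg_of_mul_nonneg_right h3 hn1]

lemma measurableSet_upperSimplex {d : ℕ} (l : Fin d) (n N : ℝ) :
    MeasurableSet (upperSimplex l n N) := by
  have := fun i => (continuous_shadowCoord (d := d) i).measurable
  have h1 : {x : Fin d → ℝ | ∀ i ≠ l, 0 ≤ shadowCoord x i} =
      ⋂ i, ⋂ (_ : i ≠ l), {x | 0 ≤ shadowCoord x i} := by
    ext; simp
  refine MeasurableSet.inter ?_ (MeasurableSet.inter ?_ ?_)
  · change MeasurableSet {x : Fin d → ℝ | ∀ i ≠ l, 0 ≤ shadowCoord x i}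
    rw [h1]
    exact .iInter fun i => .iInter fun _ => measurableSet_le measurable_const (this i)
  · exact measurableSet_le ((this l).const_mul _) (measurable_pi_apply l)
  · exact measurableSet_le (measurable_pi_apply l) ((this l).const_mul _)

lemma volume_upperSimplex {d : ℕ} (l : Fin d) {n N : ℝ} (hn : 0 ≤ n) (hN : n < N) :
    volume (upperSimplex l n N) = ENNReal.ofReal (d * (N - n) / d.factorial) := by
  have hd : (0 : ℝ) < d := by exact_mod_cast l.pos
  have hNn : 0 < N - n := by linarith
  have hn1 : 0 < n + 1 := by linarith
  have h1 : 1 + ((N - n)⁻¹ • hinge l n) (apexPoint l N) = -((n + 1) / (d * (N - n))) := by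
    rw [LinearMap.smul_apply, hinge_apexPoint, smul_eq_mul]
    field_simp
    ring
  have hpos : 0 < (n + 1) / (d * (N - n)) := by positivity
  rw [upperSimplex_eq_preimage l hn hN, volume_setOf_add_smul_mem _ _ _ (by rw [h1]; linarith),
    volume_lowerSimplex l hn, h1, ← ENNReal.ofReal_mul (abs_nonneg _), abs_inv, abs_neg,
    abs_of_pos hpos]
  congr 1
  field_simp

lemma volume_convexHull_apexVertices {d : ℕ} (l : Fin d) {n N : ℝ} (hn : 0 ≤ n) (hN : n < N) :
    volume.real (convexHull ℝ (apexVertices l n N)) =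
      (n + 1 + d * (N - n)) / d.factorial := by
  have hNn : 0 < N - n := by linarith
  rw [measureReal_def, convexHull_apexVertices_eq_union l hn hN,
    measure_union₀ (measurableSet_upperSimplex l n N).nullMeasurableSet
      (volume_lowerSimplex_inter_upperSimplex l hn hN),
    volume_lowerSimplex l hn, volume_upperSimplex l hn hN,
    ← ENNReal.ofReal_add (by positivity) (by positivity), ENNReal.toReal_ofReal (by positivity),
    ← add_div]

/-! ### Vertices -/

lemma extremePoints_convexHull_apexVertices {d : ℕ} (hd : 3 ≤ d) (l : Fin d) {n N : ℝ}
    (hn : 0 ≤ n) (hN : n < N) :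
    (convexHull ℝ (apexVertices l n N)).extremePoints ℝ = apexVertices l n N := by
  have hd3 : (3 : ℝ) ≤ d := by exact_mod_cast hd
  have hsum1 : ∀ i : Fin d, ∑ j, (Pi.single i 1 : Fin d → ℝ) j = 1 := by simp
  have hσ : ∀ x : Fin d → ℝ, (∑ i, LinearMap.proj i : (Fin d → ℝ) →ₗ[ℝ] ℝ) x = ∑ i, x i := by
    simp [LinearMap.sum_apply]
  have hdn : 0 ≤ d * n := by positivity
  have hdN : d * n < d * N := by
    have : (0 : ℝ) < d := by linarith
    gcongr
  refine extremePoints_convexHull_subset.antisymm fun v hv => ?_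
  have hv' := hv
  rcases hv' with (rfl | ⟨j, hj, rfl⟩) | rfl | rfl
  · refine mem_extremePoints_convexHull_of_forall_lt hv
      (-(∑ i, LinearMap.proj i : (Fin d → ℝ) →ₗ[ℝ] ℝ)) fun w hw hne => ?_
    simp only [LinearMap.neg_apply, hσ]
    rcases hw with (rfl | ⟨i, hi, rfl⟩) | rfl | rfl
    · exact absurd rfl hne
    · rw [hsum1]; simp
    · rw [sum_apexPoint]; simp; linarith
    · rw [sum_apexPoint]; simp; linarith
  · refine mem_extremePoints_convexHull_of_forall_lt hv
      ((LinearMap.proj j : (Fin d → ℝ) →ₗ[ℝ] ℝ) - LinearMap.proj l) fun w hw hne => ?_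
    rcases hw with (rfl | ⟨i, hi, rfl⟩) | rfl | rfl
    · simp [hj.symm]
    · have : j ≠ i := by rintro rfl; exact hne rfl
      simp [hj.symm, hi.symm, this]
    · simp [apexPoint_apply, hj]
    · simp [apexPoint_apply, hj]
  · -- The functional is a multiple of `(d - 1 / (n + 1)) x_l - ∑ x_i`.
    refine mem_extremePoints_convexHull_of_forall_lt hv
      ((d * (n + 1) - 1) • (LinearMap.proj l : (Fin d → ℝ) →ₗ[ℝ] ℝ) -
        (n + 1) • ∑ i, LinearMap.proj i) fun w hw hne => ?_
    have hval : (d * (n + 1) - 1) * apexPoint l n l - (n + 1) * ∑ i, apexPoint l n i =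
        (n + 1) * (d - 2) := by
      rw [sum_apexPoint, apexPoint_apply, if_pos rfl]
      ring
    have hpos : 0 < (n + 1) * ((d : ℝ) - 2) := mul_pos (by linarith) (by linarith)
    simp only [LinearMap.sub_apply, LinearMap.smul_apply, hσ, LinearMap.proj_apply, smul_eq_mul,
      hval]
    rcases hw with (rfl | ⟨i, hi, rfl⟩) | rfl | rfl
    · simpa using hpos
    · rw [hsum1, Pi.single_eq_of_ne hi.symm]
      linarith
    · exact absurd rfl hne
    · rw [sum_apexPoint, apexPoint_apply, if_pos rfl]
      linarith
  · refine mem_extremePoints_convexHull_of_forall_lt hv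
      (∑ i, LinearMap.proj i : (Fin d → ℝ) →ₗ[ℝ] ℝ) fun w hw hne => ?_
    simp only [hσ, sum_apexPoint]
    rcases hw with (rfl | ⟨i, hi, rfl⟩) | rfl | rfl
    · simp; linarith
    · rw [hsum1]; linarith
    · rw [sum_apexPoint]; linarith
    · exact absurd rfl hne

/-! ### Lattice points -/

lemma isLatticePoint_apexPoint {d : ℕ} (l : Fin d) (m : ℤ) : IsLatticePoint (apexPoint l m) := by
  intro i
  refine ⟨(if i = l then 1 else 0) + m, ?_⟩
  rw [apexPoint_apply]
  push_cast
  rfl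

lemma isLatticePoint_single {d : ℕ} (j : Fin d) :
    IsLatticePoint (Pi.single j 1 : Fin d → ℝ) := by
  simpa [apexPoint_zero] using isLatticePoint_apexPoint j 0

lemma isLatticePoint_smul_one {d : ℕ} (t : ℤ) : IsLatticePoint ((t : ℝ) • (1 : Fin d → ℝ)) :=
  fun i => ⟨t, by simp⟩

/-- The only lattice points whose barycentric coordinates in the shadow are all nonnegative lie
above the barycentre or above a vertex of the shadow. -/
lemma IsLatticePoint.eq_of_shadowCoord_nonneg {d : ℕ} (hd : d ≠ 0) {x : Fin d → ℝ}
    (hx : IsLatticePoint x) (h : ∀ i, 0 ≤ shadowCoord x i) :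
    (∃ t : ℤ, x = (t : ℝ) • (1 : Fin d → ℝ)) ∨ ∃ (j : Fin d) (m : ℤ), x = apexPoint j m := by
  choose z hz using hx
  have hdiff : ∀ i j, shadowCoord x i - shadowCoord x j = z i - z j := by
    intro i j
    simp [shadowCoord, hz]
  by_cases hall : ∀ i j, z i = z j
  · left
    refine ⟨z ⟨0, Nat.pos_of_ne_zero hd⟩, ?_⟩
    ext i
    rw [hz, hall i ⟨0, Nat.pos_of_ne_zero hd⟩]
    simp
  · right
    obtain ⟨j, k, hjk⟩ : ∃ j k, z k < z j := by
      push Not at hall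
      obtain ⟨i, j, hij⟩ := hall
      rcases lt_or_gt_of_ne hij with h' | h'
      · exact ⟨j, i, h'⟩
      · exact ⟨i, j, h'⟩
    have hone : 1 ≤ shadowCoord x j := by
      have : (z k : ℝ) + 1 ≤ z j := by exact_mod_cast hjk
      linarith [hdiff j k, h k]
    have hsum := sum_shadowCoord hd x
    rw [← Finset.add_sum_erase _ _ (Finset.mem_univ j)] at hsum
    have hrest : ∑ i ∈ Finset.univ.erase j, shadowCoord x i = 0 :=
      le_antisymm (by linarith) (Finset.sum_nonneg fun i _ => h i)
    have hzero : ∀ i ≠ j, shadowCoord x i = 0 := fun i hi =>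
      (Finset.sum_eq_zero_iff_of_nonneg fun i _ => h i).1 hrest i
        (Finset.mem_erase.2 ⟨hi, Finset.mem_univ i⟩)
    refine ⟨j, z j - 1, ?_⟩
    ext i
    rw [apexPoint_apply, hz]
    push_cast
    split_ifs with hi
    · rw [hi]; ring
    · have := hdiff j i
      rw [hzero i hi] at this
      linarith

lemma smul_one_mem_facetRegion_iff {d : ℕ} (l : Fin d) {n N : ℝ} {t : ℝ} :
    t • (1 : Fin d → ℝ) ∈ facetRegion l n N ↔ 0 ≤ t ∧ d * t ≤ N + 1 := by
  have hd : (0 : ℝ) < d := by exact_mod_cast l.pos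
  simp only [facetRegion, Set.mem_ofPred_eq, shadowCoord_smul_one, Pi.smul_apply, Pi.one_apply, smul_eq_mul, mul_one]
  rw [mul_one_div, le_div_iff₀' (a := t) hd]
  constructor
  · rintro ⟨h1, -, h3⟩
    exact ⟨by linarith [h1 l], h3⟩
  · rintro ⟨h1, h2⟩
    exact ⟨fun _ => by linarith, fun _ => by positivity, h2⟩

lemma apexPoint_mem_facetRegion_iff {d : ℕ} (l : Fin d) (hd : 2 ≤ d) {n N m : ℝ} :
    apexPoint l m ∈ facetRegion l n N ↔ n ≤ m ∧ m ≤ N ∧ 0 ≤ m + 1 := by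
  have hd0 : d ≠ 0 := by omega
  have : Nontrivial (Fin d) := Fin.nontrivial_iff_two_le.2 hd
  obtain ⟨k, hk⟩ := exists_ne l
  simp only [facetRegion, Set.mem_ofPred_eq, shadowCoord_apexPoint hd0, apexPoint_apply, if_true]
  constructor
  · rintro ⟨h1, -, h3⟩
    have h1k := h1 k
    have h1l := h1 l
    rw [if_neg hk] at h1k
    rw [if_pos rfl] at h1l
    exact ⟨by linarith, by linarith, by linarith⟩
  · rintro ⟨h1, h2, h3⟩
    refine ⟨fun i => ?_, fun i => ?_, by linarith⟩
    · split_ifs <;> linarith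
    · split_ifs <;> norm_num

lemma apexPoint_mem_facetRegion_of_ne {d : ℕ} {l j : Fin d} (hj : j ≠ l) {n N m : ℝ}
    (h : apexPoint j m ∈ facetRegion l n N) : m = 0 := by
  have hd0 : d ≠ 0 := by rintro rfl; exact l.elim0
  obtain ⟨h1, -, h3⟩ := h
  have h1l := h1 l
  rw [shadowCoord_apexPoint hd0, if_neg hj.symm] at h3
  rw [apexPoint_apply, if_neg hj.symm] at h1l h3
  linarith

/-- The points `t (1, …, 1)` for integers `1 ≤ t ≤ c`: the interior lattice points of
`facetRegion l n (c * d)` when `n < c * d` and `3 ≤ d`. -/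
def diagonalPoints (d c : ℕ) : Set (Fin d → ℝ) :=
  (fun t : ℕ => (t : ℝ) • (1 : Fin d → ℝ)) '' Finset.Icc 1 c

/-- The origin, the `e_i` with `i ≠ l`, and the points `e_l + m (1, …, 1)` for integers
`n ≤ m ≤ N`: the boundary lattice points of `facetRegion l n N` when `n < N`,
`d ∣ N` and `3 ≤ d`. -/
def rimPoints {d : ℕ} (l : Fin d) (n N : ℕ) : Set (Fin d → ℝ) :=
  {0} ∪ (fun i => Pi.single i 1) '' (Finset.univ.erase l : Finset (Fin d)) ∪
    (fun m : ℕ => apexPoint l m) '' Finset.Icc n N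

lemma latticePoint_mem_facetRegion_iff {d : ℕ} (hd : 3 ≤ d) (l : Fin d) {c n : ℕ}
    (hn : n < c * d) {x : Fin d → ℝ} :
    x ∈ facetRegion l (n : ℝ) ((c * d : ℕ) : ℝ) ∧ IsLatticePoint x ↔
      x ∈ diagonalPoints d c ∪ rimPoints l n (c * d) := by
  have hd0 : d ≠ 0 := by omega
  constructor
  · rintro ⟨hx, hxl⟩
    rcases hxl.eq_of_shadowCoord_nonneg hd0 hx.2.1 with ⟨t, rfl⟩ | ⟨j, m, rfl⟩
    · obtain ⟨h1, h2⟩ := (smul_one_mem_facetRegion_iff l).1 hx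
      obtain ⟨t, rfl⟩ := Int.eq_ofNat_of_zero_le (by exact_mod_cast h1 : 0 ≤ t)
      have h2' : d * t ≤ c * d + 1 := by exact_mod_cast h2
      have htc : t ≤ c := by
        -- `d * t ≤ c * d + 1` and `2 ≤ d`.
        by_contra! h
        have : d * (c + 1) ≤ d * t := Nat.mul_le_mul_left d h
        nlinarith
      rcases Nat.eq_zero_or_pos t with rfl | ht
      · right; simp [rimPoints]
      · left
        exact ⟨t, by simp; omega, by simp⟩
    · right
      by_cases hj : j = l
      · subst hj
        obtain ⟨h1, h2, -⟩ := (apexPoint_mem_facetRegion_iff j (by omega)).1 hx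
        have h1' : (n : ℤ) ≤ m := by exact_mod_cast h1
        have h2' : m ≤ ((c * d : ℕ) : ℤ) := by exact_mod_cast h2
        obtain ⟨m, rfl⟩ := Int.eq_ofNat_of_zero_le (by omega : 0 ≤ m)
        refine Or.inr ⟨m, ?_, by simp⟩
        simp only [Finset.coe_Icc, Set.mem_Icc]
        omega
      · have hm := apexPoint_mem_facetRegion_of_ne hj hx
        rw [hm, apexPoint_zero]
        exact Or.inl (Or.inr ⟨j, by simpa using hj, rfl⟩)
  · have hsub : apexVertices l (n : ℝ) ((c * d : ℕ) : ℝ) ⊆ _ :=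
      apexVertices_subset_facetRegion l (Nat.cast_nonneg n) (by exact_mod_cast hn)
    rintro (⟨t, ht, rfl⟩ | ((rfl | ⟨j, hj, rfl⟩) | ⟨m, hm, rfl⟩))
    · simp only [Finset.coe_Icc, Set.mem_Icc] at ht
      refine ⟨(smul_one_mem_facetRegion_iff l).2 ⟨by positivity, ?_⟩,
        by simpa using isLatticePoint_smul_one (d := d) (t : ℤ)⟩
      have : d * t ≤ c * d + 1 := by nlinarith [Nat.mul_le_mul_left d ht.2]
      exact_mod_cast this
    · exact ⟨hsub (by simp [apexVertices]), by simpa using isLatticePoint_smul_one (d := d) 0⟩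
    · exact ⟨hsub (Or.inl (Or.inr ⟨j, by simpa using hj, rfl⟩)), isLatticePoint_single j⟩
    · simp only [Finset.coe_Icc, Set.mem_Icc] at hm
      refine ⟨(apexPoint_mem_facetRegion_iff l (by omega)).2
        ⟨by exact_mod_cast hm.1, by exact_mod_cast hm.2, by positivity⟩,
        by simpa using isLatticePoint_apexPoint l (m : ℤ)⟩

/-! ### Interior and boundary -/

/-- Points at which all the facet inequalities are strict are interior. -/
lemma mem_interior_facetRegion {d : ℕ} {l : Fin d} {n N : ℝ} {x : Fin d → ℝ}
    (h1 : ∀ i, n * x l < (n + 1) * x i) (h2 : ∀ i, 0 < shadowCoord x i)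
    (h3 : x l < (N + 1) * shadowCoord x l) : x ∈ interior (facetRegion l n N) := by
  have hs := fun i => continuous_shadowCoord (d := d) i
  refine mem_interior_iff_mem_nhds.2 ?_
  have e1 : ∀ᶠ y in nhds x, ∀ i, n * y l < (n + 1) * y i :=
    Filter.eventually_all.2 fun i => (isOpen_lt (f := fun y : Fin d → ℝ => n * y l)
      (g := fun y => (n + 1) * y i) (by fun_prop) (by fun_prop)).mem_nhds (h1 i)
  have e2 : ∀ᶠ y in nhds x, ∀ i, 0 < shadowCoord y i :=
    Filter.eventually_all.2 fun i => (isOpen_lt continuous_const (hs i)).mem_nhds (h2 i)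
  have e3 : ∀ᶠ y in nhds x, y l < (N + 1) * shadowCoord y l :=
    (isOpen_lt (continuous_apply l) (continuous_const.mul (hs l))).mem_nhds h3
  filter_upwards [e1, e2, e3] with y y1 y2 y3
  exact ⟨fun i => (y1 i).le, fun i => (y2 i).le, y3.le⟩

lemma exists_add_smul_mem_of_mem_interior {E : Type*} [AddCommGroup E] [Module ℝ E]
    [TopologicalSpace E] [ContinuousAdd E] [ContinuousSMul ℝ E] {s : Set E} {x : E}
    (hx : x ∈ interior s) (v : E) : ∃ ε : ℝ, 0 < ε ∧ x + ε • v ∈ s := by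
  have hc : Continuous fun ε : ℝ => x + ε • v := by fun_prop
  have h : ∀ᶠ ε in nhds (0 : ℝ), x + ε • v ∈ s :=
    hc.continuousAt.eventually (by simpa using mem_interior_iff_mem_nhds.1 hx)
  have h' : ∀ᶠ ε in nhdsWithin (0 : ℝ) (Set.Ioi 0), x + ε • v ∈ s :=
    h.filter_mono nhdsWithin_le_nhds
  obtain ⟨ε, h1, h2⟩ := (h'.and self_mem_nhdsWithin).exists
  exact ⟨ε, h2, h1⟩

lemma diagonalPoints_subset_interior {d : ℕ} (hd : 3 ≤ d) (l : Fin d) (c : ℕ) (n : ℝ) :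
    diagonalPoints d c ⊆ interior (facetRegion l n ((c * d : ℕ) : ℝ)) := by
  have hd3 : (3 : ℝ) ≤ d := by exact_mod_cast hd
  have hdpos : (0 : ℝ) < d := by linarith
  rintro x ⟨t, ht, rfl⟩
  simp only [Finset.coe_Icc, Set.mem_Icc] at ht
  have ht1 : (1 : ℝ) ≤ t := by exact_mod_cast ht.1
  have ht2 : (t : ℝ) ≤ c := by exact_mod_cast ht.2
  refine mem_interior_facetRegion (fun i => ?_) (fun i => ?_) ?_
  · simp
    linarith
  · rw [shadowCoord_smul_one]; positivity
  · rw [shadowCoord_smul_one, mul_one_div, lt_div_iff₀ hdpos]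
    push_cast
    simp
    nlinarith

lemma notMem_interior_of_mem_rimPoints {d : ℕ} (hd : 3 ≤ d) {l : Fin d} {n N : ℕ} {M : ℝ}
    {x : Fin d → ℝ} (hx : x ∈ rimPoints l n N) : x ∉ interior (facetRegion l (n : ℝ) M) := by
  have hd0 : d ≠ 0 := by omega
  intro hint
  -- A vanishing coordinate `x l` cannot be decreased along `(1, …, 1)`.
  have hl : x l ≠ 0 := by
    intro h0
    obtain ⟨ε, hε, h⟩ := exists_add_smul_mem_of_mem_interior hint (-1)
    have := h.1 l
    simp [h0] at this
    linarith
  rcases hx with (rfl | ⟨j, hj, rfl⟩) | ⟨m, hm, rfl⟩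
  · simp at hl
  · have : j ≠ l := by simpa using hj
    simp [this.symm] at hl
  · -- Above a vertex of the shadow some barycentric coordinate vanishes; moving along `e_l`
    -- makes it negative.
    have : Nontrivial (Fin d) := Fin.nontrivial_iff_two_le.2 (by omega)
    obtain ⟨k, hk⟩ := exists_ne l
    obtain ⟨ε, hε, h⟩ := exists_add_smul_mem_of_mem_interior hint (Pi.single l 1)
    have h2 := h.2.1 k
    have hz := shadowCoord_apexPoint hd0 l m k
    have hdpos : (0 : ℝ) < d := by positivity
    simp only [shadowCoord, Pi.add_apply, Pi.smul_apply, smul_eq_mul, Finset.sum_add_distrib,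
      ← Finset.mul_sum, if_neg hk, Pi.single_eq_of_ne hk] at h2 hz
    have e : ∑ i, (Pi.single l 1 : Fin d → ℝ) i = 1 := by simp
    rw [e] at h2
    have : 0 < ε / d := by positivity
    have e2 : (1 - (∑ i, apexPoint l (m : ℝ) i + ε * 1)) / (d : ℝ) =
      (1 - ∑ i, apexPoint l (m : ℝ) i) / d - ε / d := by ring
    rw [e2] at h2
    linarith

lemma ncard_diagonalPoints {d : ℕ} (hd : d ≠ 0) (c : ℕ) : (diagonalPoints d c).ncard = c := by
  rw [diagonalPoints, Set.ncard_image_of_injective, Set.ncard_coe_finset, Nat.card_Icc]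
  · omega
  · intro s t h
    have := congrFun h ⟨0, Nat.pos_of_ne_zero hd⟩
    simpa using this

lemma ncard_rimPoints {d : ℕ} (hd : 3 ≤ d) (l : Fin d) (n N : ℕ) :
    (rimPoints l n N).ncard = 1 + (d - 1) + (N + 1 - n) := by
  have hnt : Nontrivial (Fin d) := Fin.nontrivial_iff_two_le.2 (by omega)
  rw [rimPoints, Set.ncard_union_eq ?_ ?_ ?_, Set.ncard_union_eq ?_ ?_ ?_, Set.ncard_singleton,
    Set.ncard_image_of_injective, Set.ncard_image_of_injective, Set.ncard_coe_finset,
    Set.ncard_coe_finset, Nat.card_Icc, Finset.card_erase_of_mem (Finset.mem_univ l),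
    Finset.card_univ, Fintype.card_fin]
  · intro s t h
    have := congrFun h l
    simpa [apexPoint_apply] using this
  · intro s t h
    by_contra hst
    have := congrFun h s
    simp [hst] at this
  · rw [Set.disjoint_singleton_left]
    rintro ⟨j, -, h⟩
    have := congrFun h j
    simp at this
  · exact Set.finite_singleton _
  · exact (Finset.finite_toSet _).image _
  · rw [Set.disjoint_left]
    rintro x hx ⟨m, -, rfl⟩
    have h1 : apexPoint l (m : ℝ) l = 1 + m := by simp [apexPoint_apply]
    have hm : (0 : ℝ) ≤ m := Nat.cast_nonneg m
    rcases hx with hx | ⟨j, hj, hx⟩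
    · have h0 : apexPoint l (m : ℝ) l = 0 := congrFun hx l
      linarith
    · have hjl : j ≠ l := by simpa using hj
      have h0 : (Pi.single j 1 : Fin d → ℝ) l = apexPoint l (m : ℝ) l := congrFun hx l
      rw [Pi.single_eq_of_ne hjl.symm] at h0
      linarith
  · exact (Set.finite_singleton _).union ((Finset.finite_toSet _).image _)
  · exact (Finset.finite_toSet _).image _

/-! ### The bipyramid polytope -/

lemma finite_apexVertices {d : ℕ} (l : Fin d) (n N : ℝ) : (apexVertices l n N).Finite := by
  refine ((Set.finite_singleton _).union ?_).union ((Set.finite_singleton _).insert _)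
  refine (Set.finite_range fun i : Fin d => (Pi.single i 1 : Fin d → ℝ)).subset ?_
  rintro x ⟨i, -, rfl⟩
  exact ⟨i, rfl⟩

lemma isLatticePoint_of_mem_apexVertices {d : ℕ} {l : Fin d} {n N : ℕ} {x : Fin d → ℝ}
    (hx : x ∈ apexVertices l (n : ℝ) (N : ℝ)) : IsLatticePoint x := by
  rcases hx with (rfl | ⟨j, -, rfl⟩) | rfl | rfl
  · simpa using isLatticePoint_smul_one (d := d) 0
  · exact isLatticePoint_single j
  · simpa using isLatticePoint_apexPoint l (n : ℤ)
  · simpa using isLatticePoint_apexPoint l (N : ℤ)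

lemma bipyramidApex_eq_apexPoint {d : ℕ} {l : Fin d} (hl : (l : ℕ) + 1 = d) (m : ℕ) :
    bipyramidApex d m = apexPoint l m := by
  have hiff : ∀ i : Fin d, (i : ℕ) + 1 = d ↔ i = l := fun i => by
    rw [Fin.ext_iff]; omega
  ext i
  simp [bipyramidApex, apexPoint_apply, hiff]

lemma bipyramidVertices_eq_apexVertices {d : ℕ} {l : Fin d} (hl : (l : ℕ) + 1 = d) (c n : ℕ) :
    bipyramidVertices c d n = apexVertices l (n : ℝ) ((c * d : ℕ) : ℝ) := by
  have hiff : ∀ i : Fin d, (i : ℕ) + 1 < d ↔ i ≠ l := fun i => by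
    rw [ne_eq, Fin.ext_iff]; omega
  simp only [bipyramidVertices, apexVertices, bipyramidApex_eq_apexPoint hl, hiff]

theorem mainTheorem1 (c d n : ℕ) (hc : 1 ≤ c) (hd : 3 ≤ d) (hn : n < c * d) :
    (bipyramidPolytope c d n).extremePoints ℝ = bipyramidVertices c d n ∧
    IsCastelnuovo (bipyramidPolytope c d n) ∧
    (boundaryLatticeCount (bipyramidPolytope c d n) : ℤ) = (c : ℤ) * d - n + (d + 1) ∧
    interiorLatticeCount (bipyramidPolytope c d n) = c := by
  obtain ⟨l, hl⟩ : ∃ l : Fin d, (l : ℕ) + 1 = d :=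
    ⟨⟨d - 1, by omega⟩, Nat.sub_add_cancel (by omega)⟩
  have hV := bipyramidVertices_eq_apexVertices hl c n
  have hn0 : (0 : ℝ) ≤ n := Nat.cast_nonneg n
  have hnN : (n : ℝ) < ((c * d : ℕ) : ℝ) := by exact_mod_cast hn
  have hP : bipyramidPolytope c d n = convexHull ℝ (apexVertices l (n : ℝ) ((c * d : ℕ) : ℝ)) := by
    rw [bipyramidPolytope, hV]
  have hPQ : bipyramidPolytope c d n = facetRegion l (n : ℝ) ((c * d : ℕ) : ℝ) := by
    rw [hP, convexHull_apexVertices_eq_facetRegion l hn0 hnN]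
  have hclosed : IsClosed (bipyramidPolytope c d n) := by
    rw [hP]
    exact ((finite_apexVertices l _ _).isCompact_convexHull (𝕜 := ℝ)).isClosed
  have hext : (bipyramidPolytope c d n).extremePoints ℝ = bipyramidVertices c d n := by
    rw [hP, hV, extremePoints_convexHull_apexVertices hd l hn0 hnN]
  have hdiag := diagonalPoints_subset_interior hd l c n
  have hint : {x | x ∈ interior (bipyramidPolytope c d n) ∧ IsLatticePoint x} =
      diagonalPoints d c := by
    rw [hPQ]
    ext x
    constructor
    · rintro ⟨hx, hxl⟩
      rcases (latticePoint_mem_facetRegion_iff hd l hn).1 ⟨interior_subset hx, hxl⟩ with h | h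
      · exact h
      · exact absurd hx (notMem_interior_of_mem_rimPoints hd h)
    · intro hx
      exact ⟨hdiag hx, ((latticePoint_mem_facetRegion_iff hd l hn).2 (Or.inl hx)).2⟩
  have hbd : {x | x ∈ frontier (bipyramidPolytope c d n) ∧ IsLatticePoint x} =
      rimPoints l n (c * d) := by
    rw [hclosed.frontier_eq, hPQ]
    ext x
    constructor
    · rintro ⟨⟨hx, hx'⟩, hxl⟩
      rcases (latticePoint_mem_facetRegion_iff hd l hn).1 ⟨hx, hxl⟩ with h | h
      · exact absurd (hdiag h) hx'
      · exact h
    · intro hx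
      obtain ⟨h1, h2⟩ := (latticePoint_mem_facetRegion_iff hd l hn).2 (Or.inr hx)
      exact ⟨⟨h1, notMem_interior_of_mem_rimPoints hd hx⟩, h2⟩
  have hcount : interiorLatticeCount (bipyramidPolytope c d n) = c := by
    rw [interiorLatticeCount, hint, ncard_diagonalPoints (by omega)]
  have hbcount : (boundaryLatticeCount (bipyramidPolytope c d n) : ℤ) =
      (c : ℤ) * d - n + (d + 1) := by
    rw [boundaryLatticeCount, hbd, ncard_rimPoints hd l, ← Nat.cast_mul]
    omega
  refine ⟨hext, ⟨⟨⟨_, finite_apexVertices l _ _, hP⟩, ?_, ?_⟩, by omega, ?_⟩, hbcount, hcount⟩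
  · refine affineSpan_eq_top_of_nonempty_interior ⟨(((1 : ℕ) : ℝ)) • 1, ?_⟩
    rw [hPQ]
    exact interior_mono (subset_convexHull ℝ _) (hdiag ⟨1, by simpa using hc, rfl⟩)
  · intro x hx
    rw [hext, hV] at hx
    exact isLatticePoint_of_mem_apexVertices hx
  · have hb : (boundaryLatticeCount (bipyramidPolytope c d n) : ℝ) =
        (c : ℝ) * d - n + (d + 1) := by exact_mod_cast hbcount
    rw [hb, hcount, hP, volume_convexHull_apexVertices l hn0 hnN]
    push_cast
    ring
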